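/- Let $\Bbbk$ be a field of characteristic zero and $\Omega$ a set. An algebra is a linear space over $\Bbbk$ with bilinear operations $\circ_\omega$, $\omega\in\Omega$; a variety is a class of algebras defined by a set of identities. For a variety $\mathfrak V$, the codimension $c_n(\mathfrak V)\in\mathbb N\cup\{\infty\}$ ($n\ge 1$) is the dimension of the space of multilinear polynomials of degree $n$ in $x_1,\dots,x_n$ in the free algebra $\mathfrak V\langle x_1,x_2,\dots\rangle$. The variety $\mathfrak V$ has intermediate (codimension) growth if the sequence $c_n(\mathfrak V)$ is subexponential (for every real $a>1$ there is $C$ with $c_n(\mathfrak V)\le C a^n$ for all $n\ge 1$) but is not bounded from above by a polynomial in $n$. A $\mathrm{Perm}$-algebra is an associative algebra $P$ with the identity $(xy-yx)z=0$. For a variety $\mathfrak M$ of algebras with operations $\circ_\omega$, let $\mathrm{di}\text{-}\mathfrak M$ be the variety of algebras with operations $\vdash_\omega,\dashv_\omega$, $\omega\in\Omega$, generated by all spaces $P\otimes A$, where $P$ is a $\mathrm{Perm}$-algebra and $A\in\mathfrak M$, with $$(p\otimes a)\vdash_\omega(q\otimes b)=pq\otimes (a\circ_\omega b),\qquad (p\otimes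 a)\dashv_\omega(q\otimes b)=qp\otimes (a\circ_\omega b).$$ Corollary 3. If a variety $\mathfrak M$ of algebras has no subvarieties of intermediate codimension growth, then $\mathrm{di}\text{-}\mathfrak M$ has no subvarieties of intermediate codimension growth. In particular, if the variety of Lie algebras over $\Bbbk$ has no subvarieties of intermediate codimension growth, then neither has the variety of (left) Leibniz algebras over $\Bbbk$, i.e. of algebras with one operation satisfying $[x,[y,z]]=[[x,y],z]+[y,[x,z]]$. -/

import Mathlib

universe u v w

open scoped TensorProduct

noncomputable section

namespace DiVar

/-- A linear algebra over `k` with a family of bilinear operations indexed by `Ω`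
(no associativity, commutativity or unit is required). -/
structure OpAlg (k : Type u) [Field k] (Ω : Type v) where
  /-- the underlying linear space -/
  carrier : Type w
  [addCommGroup : AddCommGroup carrier]
  [module : Module k carrier]
  /-- the operations -/
  op : Ω → carrier →ₗ[k] carrier →ₗ[k] carrier

attribute [instance] OpAlg.addCommGroup OpAlg.module

/-- Non-associative monomials in the variables `x₀, x₁, …`, with product symbols from `Ω`. -/
inductive Monomial (Ω : Type v) : Type v
  | var : ℕ → Monomial Ω
  | mul : Ω → Monomial Ω → Monomial Ω → Monomial Ω

/-- The multiset of the variables of a monomial, counted with multiplicity. -/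
def Monomial.vars {Ω : Type v} : Monomial Ω → Multiset ℕ
  | .var i => {i}
  | .mul _ s t => s.vars + t.vars

/-- The space of non-associative polynomials in `x₀, x₁, …`, that is, the underlying linear space
of the free algebra with operations `Ω` on countably many generators. -/
abbrev Poly (k : Type u) [Field k] (Ω : Type v) : Type (max u v) := Monomial Ω →₀ k

section Identities

variable {k : Type u} [Field k] {Ω : Type v}

/-- The value of a monomial at a point of an algebra. -/
def Monomial.eval (A : OpAlg.{u, v, w} k Ω) (x : ℕ → A.carrier) : Monomial Ω → A.carrier
  | .var i => x i
  | .mul ω s t => A.op ω (s.eval A x) (t.eval A x)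

/-- The value of a polynomial at a point of an algebra. -/
def Poly.eval (A : OpAlg.{u, v, w} k Ω) (x : ℕ → A.carrier) : Poly k Ω →ₗ[k] A.carrier :=
  Finsupp.linearCombination k (Monomial.eval A x)

/-- `f = 0` is an identity on the algebra `A`. -/
def OpAlg.Satisfies (A : OpAlg.{u, v, w} k Ω) (f : Poly k Ω) : Prop :=
  ∀ x : ℕ → A.carrier, Poly.eval A x f = 0

/-- The variable `xᵢ` as a polynomial. -/
def Poly.X (k : Type u) [Field k] (Ω : Type v) (i : ℕ) : Poly k Ω :=
  Finsupp.single (Monomial.var i) 1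

/-- The product of two polynomials with respect to the operation `ω`, i.e. the operation of the
free algebra. -/
def Poly.mul (ω : Ω) (f g : Poly k Ω) : Poly k Ω :=
  f.sum fun s a => g.sum fun t b => Finsupp.single (Monomial.mul ω s t) (a * b)

end Identities

/-- A variety of algebras: the class of all algebras satisfying some set of identities. The
carriers range over a universe that contains the free algebras. -/
structure Variety (k : Type u) [Field k] (Ω : Type v) where
  /-- the algebras of the variety -/
  algebras : Set (OpAlg.{u, v, max u v} k Ω)
  exists_identities : ∃ S : Set (Poly k Ω), algebras = {A | ∀ f ∈ S, A.Satisfies f}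

namespace Variety

variable {k : Type u} [Field k] {Ω : Type v}

/-- The variety defined by a set of identities. -/
def ofIdentities (S : Set (Poly k Ω)) : Variety k Ω where
  algebras := {A | ∀ f ∈ S, A.Satisfies f}
  exists_identities := ⟨S, rfl⟩

/-- The variety generated by a class of algebras: all algebras satisfying every identity that
holds on the whole class. -/
def generatedBy (C : Set (OpAlg.{u, v, max u v} k Ω)) : Variety k Ω :=
  ofIdentities {f | ∀ A ∈ C, A.Satisfies f}

/-- The ideal of identities of a variety. -/
def identities (V : Variety k Ω) : Submodule k (Poly k Ω) where
  carrier := {f | ∀ A ∈ V.algebras, A.Satisfies f}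
  add_mem' {f g} hf hg A hA x := by rw [map_add, hf A hA x, hg A hA x, add_zero]
  zero_mem' A _ x := map_zero _
  smul_mem' c f hf A hA x := by rw [map_smul, hf A hA x, smul_zero]

/-- The underlying linear space of the free algebra `V⟨x₀, x₁, …⟩` of the variety. -/
abbrev FreeAlgebra (V : Variety k Ω) : Type (max u v) := Poly k Ω ⧸ V.identities

/-- The space of multilinear polynomials of degree `n` in the free algebra of the variety: the
image of the span of the monomials in which each of the `n` variables `x₀, …, xₙ₋₁` occurs exactly
once, and no other variable occurs. -/
def multilinear (V : Variety k Ω) (n : ℕ) : Submodule k V.FreeAlgebra :=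
  (Finsupp.supported k k {t : Monomial Ω | t.vars = Multiset.range n}).map V.identities.mkQ

/-- The `n`th codimension `cₙ(V)`; its value is `⊤` if the space is infinite-dimensional, which can
happen only for infinite `Ω`. -/
def codim (V : Variety k Ω) (n : ℕ) : ℕ∞ :=
  Cardinal.toENat (Module.rank k (V.multilinear n))

end Variety

/-- The sequence is bounded from above by a polynomial in `n`. -/
def PolynomiallyBounded (c : ℕ → ℕ∞) : Prop :=
  ∃ C d : ℕ, ∀ n : ℕ, 1 ≤ n → c n ≤ (C : ℕ∞) * (n : ℕ∞) ^ d

/-- The sequence has subexponential growth: it is `O(aⁿ)` for every `a > 1`. -/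
def Subexponential (c : ℕ → ℕ∞) : Prop :=
  ∀ a : ℝ, 1 < a → ∃ C : ℝ, ∀ n : ℕ, 1 ≤ n → (c n : ENNReal) ≤ ENNReal.ofReal (C * a ^ n)

/-- Intermediate growth: subexponential, but not bounded by a polynomial. -/
def IntermediateGrowth (c : ℕ → ℕ∞) : Prop :=
  Subexponential c ∧ ¬ PolynomiallyBounded c

/-- No subvariety of `M` has intermediate codimension growth. -/
def Variety.NoIntermediateSubvariety {k : Type u} [Field k] {Ω : Type v} (M : Variety k Ω) : Prop :=
  ∀ V : Variety k Ω, V.algebras ⊆ M.algebras → ¬ IntermediateGrowth V.codim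

section Dialgebras

variable {k : Type u} [Field k] {Ω : Type v}

/-- The product `mul` makes `P` a `Perm`-algebra: it is associative, and `(x y - y x) z = 0`. -/
structure IsPerm {P : Type w} [AddCommGroup P] [Module k P] (mul : P →ₗ[k] P →ₗ[k] P) : Prop where
  assoc : ∀ x y z : P, mul (mul x y) z = mul x (mul y z)
  perm : ∀ x y z : P, mul (mul x y - mul y x) z = 0

/-- The algebra `P ⊗ A` with the doubled family of operations: `Sum.inl ω` stands for `⊢_ω` and
`Sum.inr ω` for `⊣_ω`, where `(p ⊗ a) ⊢_ω (q ⊗ b) = p q ⊗ (a ∘_ω b)` and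
`(p ⊗ a) ⊣_ω (q ⊗ b) = q p ⊗ (a ∘_ω b)`. -/
def permTensor {P : Type (max u v)} [AddCommGroup P] [Module k P] (mul : P →ₗ[k] P →ₗ[k] P)
    (A : OpAlg.{u, v, max u v} k Ω) : OpAlg.{u, v, max u v} k (Ω ⊕ Ω) where
  carrier := P ⊗[k] A.carrier
  op
    | .inl ω => TensorProduct.map₂ mul (A.op ω)
    | .inr ω => TensorProduct.map₂ mul.flip (A.op ω)

/-- The variety `di-M` of dialgebras, generated by all `P ⊗ A` with `P` a `Perm`-algebra and `A`
in `M`. -/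
def Variety.di (M : Variety k Ω) : Variety k (Ω ⊕ Ω) :=
  Variety.generatedBy {D | ∃ (P : Type (max u v)) (_ : AddCommGroup P) (_ : Module k P)
    (mul : P →ₗ[k] P →ₗ[k] P) (A : OpAlg.{u, v, max u v} k Ω),
    IsPerm mul ∧ A ∈ M.algebras ∧ D = permTensor mul A}

end Dialgebras

section LieLeibniz

variable (k : Type u) [Field k]

/-- The polynomial `[x, [y, z]] - [[x, y], z] - [y, [x, z]]`. -/
def leibnizPoly : Poly k Unit :=
  let x := Poly.X k Unit 0
  let y := Poly.X k Unit 1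
  let z := Poly.X k Unit 2
  Poly.mul () x (Poly.mul () y z) - Poly.mul () (Poly.mul () x y) z
    - Poly.mul () y (Poly.mul () x z)

/-- The variety of (left) Leibniz algebras over `k`. -/
def leib : Variety k Unit :=
  Variety.ofIdentities {leibnizPoly k}

/-- The variety of Lie algebras over `k`: alternating Leibniz algebras. -/
def lie : Variety k Unit :=
  Variety.ofIdentities {Poly.mul () (Poly.X k Unit 0) (Poly.X k Unit 0), leibnizPoly k}

end LieLeibniz

end DiVar

end

/-! A dialgebra `D` in a subvariety of `M.di` can be traded for an ordinary algebra without losing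
codimension growth. Divide `D` by the elements that act trivially through `⊢` on the left and `⊣` on
the right. The two copies of each operation agree on the quotient, `D` is a bimodule over it, and
the split null extension `hat` of the quotient by `D` is an `Ω`-algebra.

Growth is compared through multilinear polynomials. Modulo the identities of such dialgebras, a
multilinear dimonomial depends only on its underlying monomial and its central variable
(`eval_mark_centre`). Since the kernel of `hat` has square zero, a multilinear `f` of degree `n ≥ 1`
vanishes on the hats exactly when its `n` markings vanish on the dialgebras (`mem_identities_hats`).
Hence each of the two codimensions is at most `n` times the other, and a factor `n` affects neither
subexponentiality nor polynomial boundedness.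

It remains to see that the hats lie in `M` (`hat_mem_of_mem_di`). For `hat` to satisfy `f`, three
dialgebra identities built from `f` suffice (`hat_satisfies`). They hold on each generator `P ⊗ A`,
which embeds as a square-zero part into `R ⊗ A` for a commutative `R`
(`exists_envelope_permTensor`), and scalar extension over an infinite field preserves all
identities. Characteristic zero enters only through this infiniteness.

For Leibniz algebras, put `x ⊢ y = [x, y]` and `x ⊣ y = -[y, x]`. The hat is then checked directly
to be a Lie algebra, so no identification of `leib` with `(lie k).di` is needed and the field may be
arbitrary. -/

noncomputable section

namespace DiVar

universe w'

/-! ### Dimonomials, null envelopes and split null extensions -/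

section Envelopes

variable {k : Type u} [Field k] {Ω : Type v}

theorem Poly.eval_single (A : OpAlg.{u, v, w} k Ω) (x : ℕ → A.carrier) (t : Monomial Ω) (c : k) :
    Poly.eval A x (Finsupp.single t c) = c • t.eval A x := by
  simp [Poly.eval]

theorem Poly.eval_X (A : OpAlg.{u, v, w} k Ω) (x : ℕ → A.carrier) (i : ℕ) :
    Poly.eval A x (Poly.X k Ω i) = x i := by
  simp [Poly.X, Poly.eval_single, Monomial.eval]

theorem Poly.eval_mul (A : OpAlg.{u, v, w} k Ω) (x : ℕ → A.carrier) (ω : Ω) (f g : Poly k Ω) :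
    Poly.eval A x (Poly.mul ω f g) = A.op ω (Poly.eval A x f) (Poly.eval A x g) := by
  conv_rhs => rw [Poly.eval, Finsupp.linearCombination_apply, Finsupp.linearCombination_apply]
  simp only [Poly.mul, Finsupp.sum, map_sum, Poly.eval_single, Monomial.eval, map_smul,
    LinearMap.sum_apply, LinearMap.smul_apply, Finset.smul_sum, smul_smul]
  rw [Finset.sum_comm]
  simp only [mul_comm]

theorem Monomial.eval_congr (A : OpAlg.{u, v, w} k Ω) {x y : ℕ → A.carrier} (t : Monomial Ω)
    (h : ∀ i ∈ t.vars, x i = y i) : t.eval A x = t.eval A y := by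
  induction t with
  | var i => exact h i (by simp [Monomial.vars])
  | mul ω s t hs ht =>
    simp only [Monomial.eval]
    rw [hs fun i hi => h i (by simp [Monomial.vars, hi]),
      ht fun i hi => h i (by simp [Monomial.vars, hi])]

theorem Monomial.eval_eq_zero (A : OpAlg.{u, v, w} k Ω) {x : ℕ → A.carrier} (t : Monomial Ω)
    {i : ℕ} (hi : i ∈ t.vars) (h : x i = 0) : t.eval A x = 0 := by
  induction t with
  | var j =>
    obtain rfl : i = j := by simpa [Monomial.vars] using hi
    exact h
  | mul ω s t hs ht =>
    rcases Multiset.mem_add.1 hi with hi | hi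
    · simp [Monomial.eval, hs hi]
    · simp [Monomial.eval, ht hi]

/-- The monomial obtained by identifying the two copies of every operation. -/
def Monomial.forget : Monomial (Ω ⊕ Ω) → Monomial Ω
  | .var i => .var i
  | .mul ω s t => .mul (ω.elim id id) s.forget t.forget

/-- The dimonomial over `t` whose centre is the variable `xᵢ`, if `xᵢ` occurs in `t` once. -/
def Monomial.mark (i : ℕ) : Monomial Ω → Monomial (Ω ⊕ Ω)
  | .var j => .var j
  | .mul ω s t => if i ∈ t.vars then .mul (.inl ω) (s.mark i) (t.mark i)
      else .mul (.inr ω) (s.mark i) (t.mark i)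

/-- The central variable of a dimonomial. -/
def Monomial.centre : Monomial (Ω ⊕ Ω) → ℕ
  | .var i => i
  | .mul (.inl _) _ t => t.centre
  | .mul (.inr _) s _ => s.centre

theorem Monomial.vars_forget (t : Monomial (Ω ⊕ Ω)) : t.forget.vars = t.vars := by
  induction t with
  | var i => rfl
  | mul ω s t hs ht => simp [Monomial.forget, Monomial.vars, hs, ht]

theorem Monomial.vars_mark (i : ℕ) (t : Monomial Ω) : (t.mark i).vars = t.vars := by
  induction t with
  | var i => rfl
  | mul ω s t hs ht =>
    simp only [Monomial.mark]
    split_ifs <;> simp [Monomial.vars, hs, ht]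

theorem Monomial.forget_mark (i : ℕ) (t : Monomial Ω) : (t.mark i).forget = t := by
  induction t with
  | var i => rfl
  | mul ω s t hs ht =>
    simp only [Monomial.mark]
    split_ifs <;> simp [Monomial.forget, hs, ht]

theorem Monomial.centre_mem (t : Monomial (Ω ⊕ Ω)) : t.centre ∈ t.vars := by
  induction t with
  | var i => simp [Monomial.centre, Monomial.vars]
  | mul ω s t hs ht => cases ω <;> simp [Monomial.centre, Monomial.vars, hs, ht]

/-- An algebra `E` together with two maps `D → E` from a dialgebra, through which `D` becomes
an `E`-bimodule and a square-zero part of `E`. -/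
structure NullEnvelope (D : OpAlg.{u, v, w} k (Ω ⊕ Ω)) (E : OpAlg.{u, v, w'} k Ω) where
  /-- the map onto the acting part -/
  base : D.carrier →ₗ[k] E.carrier
  /-- the embedding of the square-zero part -/
  fiber : D.carrier →ₗ[k] E.carrier
  fiber_injective : Function.Injective fiber
  base_left : ∀ ω a b, base (D.op (.inl ω) a b) = E.op ω (base a) (base b)
  base_right : ∀ ω a b, base (D.op (.inr ω) a b) = E.op ω (base a) (base b)
  fiber_left : ∀ ω a b, fiber (D.op (.inl ω) a b) = E.op ω (base a) (fiber b)
  fiber_right : ∀ ω a b, fiber (D.op (.inr ω) a b) = E.op ω (fiber a) (base b)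
  fiber_fiber : ∀ ω a b, E.op ω (fiber a) (fiber b) = 0

namespace NullEnvelope

variable {D : OpAlg.{u, v, w} k (Ω ⊕ Ω)} {E : OpAlg.{u, v, w'} k Ω} (e : NullEnvelope D E)


theorem base_eval (x : ℕ → D.carrier) (t : Monomial (Ω ⊕ Ω)) :
    e.base (t.eval D x) = t.forget.eval E (fun j => e.base (x j)) := by
  induction t with
  | var i => rfl
  | mul ω s t hs ht =>
    cases ω <;> simp [Monomial.eval, Monomial.forget, e.base_left, e.base_right, hs, ht]

/-- Under `fiber`, the factor without the centre is seen only through `base`, which does not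
distinguish the two copies of an operation; one then descends into the factor containing the centre.
Repetition-freeness ensures that the centre does not reappear in the other factor, where it would
mislead `mark`. -/
theorem eval_mark_centre (e : NullEnvelope D E) (x : ℕ → D.carrier) (t : Monomial (Ω ⊕ Ω)) (h : t.vars.Nodup) :
    (t.forget.mark t.centre).eval D x = t.eval D x := by
  induction t with
  | var i => rfl
  | mul ω s t hs ht =>
    obtain ⟨hs', ht', hd⟩ := Multiset.nodup_add.1 h
    have key : ∀ (i : ℕ) (r : Monomial (Ω ⊕ Ω)),
        e.base ((r.forget.mark i).eval D x) = e.base (r.eval D x) := fun i r => by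
      rw [e.base_eval, e.base_eval, Monomial.forget_mark]
    apply e.fiber_injective
    cases ω with
    | inl ω =>
      have hm : t.centre ∈ t.forget.vars := by rw [t.vars_forget]; exact t.centre_mem
      simp [Monomial.forget, Monomial.centre, Monomial.mark, hm, Monomial.eval, e.fiber_left, key,
        ht ht']
    | inr ω =>
      have hm : s.centre ∉ t.forget.vars := by
        rw [t.vars_forget]; exact Multiset.disjoint_left.1 hd s.centre_mem
      simp [Monomial.forget, Monomial.centre, Monomial.mark, hm, Monomial.eval, e.fiber_right, key,
        hs hs']

/-- A first-order Taylor expansion: terms with two fiber factors vanish, and the term with its fiber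
factor at `i` is the dimonomial centred at `i`. As `i` occurs only once, updating `a` at `i` leaves
all other factors alone. -/
theorem eval_of_nodup (a m : ℕ → D.carrier) (t : Monomial Ω) (h : t.vars.Nodup) :
    t.eval E (fun j => e.base (a j) + e.fiber (m j)) = t.eval E (fun j => e.base (a j)) +
      e.fiber (∑ i ∈ t.vars.toFinset, (t.mark i).eval D (Function.update a i (m i))) := by
  induction t with
  | var i => simp [Monomial.eval, Monomial.vars, Monomial.mark]
  | mul ω s t hs ht =>
    obtain ⟨hs', ht', hd⟩ := Multiset.nodup_add.1 h
    have key : ∀ (i : ℕ) (r : Monomial Ω), i ∉ r.vars →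
        e.base ((r.mark i).eval D (Function.update a i (m i))) =
          r.eval E (fun j => e.base (a j)) := fun i r hi => by
      rw [e.base_eval, Monomial.forget_mark]
      refine Monomial.eval_congr _ _ fun j hj => ?_
      rw [Function.update_of_ne (by rintro rfl; exact hi hj)]
    have hdf : Disjoint s.vars.toFinset t.vars.toFinset := by
      rwa [Multiset.disjoint_toFinset]
    have h1 : e.fiber (∑ i ∈ s.vars.toFinset,
        ((Monomial.mul ω s t).mark i).eval D (Function.update a i (m i))) =
        E.op ω (e.fiber (∑ i ∈ s.vars.toFinset, (s.mark i).eval D (Function.update a i (m i))))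
          (t.eval E (fun j => e.base (a j))) := by
      rw [map_sum, map_sum, map_sum, LinearMap.sum_apply]
      refine Finset.sum_congr rfl fun i hi => ?_
      have hit : i ∉ t.vars := Multiset.disjoint_left.1 hd (Multiset.mem_toFinset.1 hi)
      simp [Monomial.mark, hit, Monomial.eval, e.fiber_right, key i t hit]
    have h2 : e.fiber (∑ i ∈ t.vars.toFinset,
        ((Monomial.mul ω s t).mark i).eval D (Function.update a i (m i))) =
        E.op ω (s.eval E (fun j => e.base (a j)))
          (e.fiber (∑ i ∈ t.vars.toFinset, (t.mark i).eval D (Function.update a i (m i)))) := by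
      rw [map_sum, map_sum, map_sum]
      refine Finset.sum_congr rfl fun i hi => ?_
      have hit : i ∈ t.vars := Multiset.mem_toFinset.1 hi
      have his : i ∉ s.vars := fun his => Multiset.disjoint_left.1 hd his hit
      simp [Monomial.mark, hit, Monomial.eval, e.fiber_left, key i s his]
    rw [Monomial.eval, hs hs', ht ht', Monomial.vars, Multiset.toFinset_add,
      ← Finset.disjUnion_eq_union _ _ hdf, Finset.sum_disjUnion, map_add e.fiber, h1, h2]
    simp only [map_add, LinearMap.add_apply, e.fiber_fiber, add_zero, Monomial.eval]
    abel

end NullEnvelope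

/-- The relations `(a ⊢ b) ⊢ c = (a ⊣ b) ⊢ c` and `c ⊣ (a ⊢ b) = c ⊣ (a ⊣ b)`. -/
structure OpAlg.BarInvariant (D : OpAlg.{u, v, w} k (Ω ⊕ Ω)) : Prop where
  left : ∀ ω ω' a b c, D.op (.inl ω') (D.op (.inl ω) a b) c = D.op (.inl ω') (D.op (.inr ω) a b) c
  right : ∀ ω ω' a b c, D.op (.inr ω') c (D.op (.inl ω) a b) = D.op (.inr ω') c (D.op (.inr ω) a b)

theorem NullEnvelope.barInvariant {D : OpAlg.{u, v, w} k (Ω ⊕ Ω)} {E : OpAlg.{u, v, w'} k Ω}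
    (e : NullEnvelope D E) : D.BarInvariant where
  left ω ω' a b c := e.fiber_injective (by simp only [e.fiber_left, e.base_left, e.base_right])
  right ω ω' a b c := e.fiber_injective (by simp only [e.fiber_right, e.base_left, e.base_right])

namespace OpAlg

variable (D : OpAlg.{u, v, w} k (Ω ⊕ Ω))

/-- The elements that act trivially by left multiplications `⊢` and right multiplications `⊣`. -/
def trivialActing : Submodule k D.carrier where
  carrier := {z | ∀ ω d, D.op (.inl ω) z d = 0 ∧ D.op (.inr ω) d z = 0}
  add_mem' ha hb ω d := by simp [(ha ω d).1, (ha ω d).2, (hb ω d).1, (hb ω d).2]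
  zero_mem' ω d := by simp
  smul_mem' c a ha ω d := by simp [(ha ω d).1, (ha ω d).2]

theorem mem_trivialActing {z : D.carrier} :
    z ∈ D.trivialActing ↔ ∀ ω d, D.op (.inl ω) z d = 0 ∧ D.op (.inr ω) d z = 0 := Iff.rfl

/-- The left action of the quotient by the trivially acting elements. -/
def actLeft (ω : Ω) : (D.carrier ⧸ D.trivialActing) →ₗ[k] D.carrier →ₗ[k] D.carrier :=
  D.trivialActing.liftQ (D.op (.inl ω)) fun _ hz => LinearMap.ext fun d => (hz ω d).1

/-- The right action of the quotient by the trivially acting elements. -/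
def actRight (ω : Ω) : (D.carrier ⧸ D.trivialActing) →ₗ[k] D.carrier →ₗ[k] D.carrier :=
  D.trivialActing.liftQ (D.op (.inr ω)).flip fun _ hz => LinearMap.ext fun d => (hz ω d).2

variable {D}

theorem op_left_mem_trivialActing (ω : Ω) {z : D.carrier}
    (hz : z ∈ D.trivialActing) (a : D.carrier) : D.op (.inl ω) z a ∈ D.trivialActing := by
  rw [(hz ω a).1]; exact zero_mem _

/-- Inside an acting argument `a ⊢ z` may be replaced by `a ⊣ z`, which is zero. -/
theorem BarInvariant.right_mem (h : D.BarInvariant) (ω : Ω) {z : D.carrier}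
    (hz : z ∈ D.trivialActing) (a : D.carrier) : D.op (.inl ω) a z ∈ D.trivialActing := by
  intro ω' d
  rw [h.left, h.right, (hz ω a).2]
  simp

/-- The quotient of a dialgebra by the trivially acting elements: its two copies of every
operation coincide. -/
def BarInvariant.quotOp (h : D.BarInvariant) (ω : Ω) :
    (D.carrier ⧸ D.trivialActing) →ₗ[k] (D.carrier ⧸ D.trivialActing) →ₗ[k]
      (D.carrier ⧸ D.trivialActing) :=
  D.trivialActing.liftQ
    (D.trivialActing.liftQ ((D.op (.inl ω)).compr₂ D.trivialActing.mkQ).flip fun _ hz =>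
      LinearMap.ext fun a => (Submodule.Quotient.mk_eq_zero _).2 (h.right_mem ω hz a)).flip
    fun z hz => LinearMap.ext fun b => by
      obtain ⟨b, rfl⟩ := D.trivialActing.mkQ_surjective b
      exact (Submodule.Quotient.mk_eq_zero _).2 (op_left_mem_trivialActing ω hz b)

/-- The split null extension of the quotient of `D` by its trivially acting elements with
kernel `D`. -/
def BarInvariant.hat (h : D.BarInvariant) : OpAlg.{u, v, w} k Ω where
  carrier := (D.carrier ⧸ D.trivialActing) × D.carrier
  op ω := LinearMap.mk₂ k
    (fun x y => (h.quotOp ω x.1 y.1, D.actLeft ω x.1 y.2 + D.actRight ω y.1 x.2))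
    (fun x x' y => by ext <;> simp; abel) (fun c x y => by ext <;> simp)
    (fun x y y' => by ext <;> simp; abel) (fun c x y => by ext <;> simp)

/-- The split null extension is an envelope. -/
def BarInvariant.envelope (h : D.BarInvariant) : NullEnvelope D h.hat where
  base := LinearMap.inl k _ _ ∘ₗ D.trivialActing.mkQ
  fiber := LinearMap.inr k _ _
  fiber_injective := LinearMap.inr_injective
  base_left ω a b := by
    refine Prod.ext rfl ?_
    change (0 : D.carrier) = D.actLeft ω _ 0 + D.actRight ω _ 0
    simp
  base_right ω a b := by
    refine Prod.ext ((Submodule.Quotient.eq _).2 fun ω' d => ?_) ?_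
    · simp [h.left, h.right]
    · change (0 : D.carrier) = D.actLeft ω _ 0 + D.actRight ω _ 0
      simp
  fiber_left ω a b := by
    refine Prod.ext ?_ ?_
    · change 0 = h.quotOp ω _ 0
      simp
    · change D.op (.inl ω) a b = D.op (.inl ω) a b + D.actRight ω 0 0
      simp
  fiber_right ω a b := by
    refine Prod.ext ?_ ?_
    · change 0 = h.quotOp ω 0 _
      simp
    · change D.op (.inr ω) a b = D.actLeft ω 0 0 + D.op (.inr ω) a b
      simp
  fiber_fiber ω a b := by
    refine Prod.ext ?_ ?_
    · change h.quotOp ω 0 0 = 0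
      simp
    · change D.actLeft ω 0 b + D.actRight ω 0 a = 0
      simp

theorem BarInvariant.exists_base_add_fiber (h : D.BarInvariant) (z : h.hat.carrier) :
    ∃ a m, z = h.envelope.base a + h.envelope.fiber m := by
  obtain ⟨z, m⟩ := z
  obtain ⟨a, rfl⟩ := D.trivialActing.mkQ_surjective z
  refine ⟨a, m, ?_⟩
  refine Prod.ext ?_ ?_
  · change D.trivialActing.mkQ a = D.trivialActing.mkQ a + 0
    simp
  · change m = 0 + m
    simp

theorem BarInvariant.base_eq_zero_iff (h : D.BarInvariant) (a : D.carrier) :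
    h.envelope.base a = 0 ↔ a ∈ D.trivialActing := by
  rw [← Submodule.Quotient.mk_eq_zero]
  exact ⟨fun h => congrArg Prod.fst h, fun h => Prod.ext h rfl⟩

end OpAlg

end Envelopes

/-! ### Comparison of codimensions of dialgebras and of their hats -/

section CodimensionComparison

variable {k : Type u} [Field k] {Ω : Type v}

/-- The multilinear polynomials of degree `n` in the variables `x₀, …, xₙ₋₁`. -/
def multilinearPoly (k : Type u) [Field k] (Ω : Type v) (n : ℕ) : Submodule k (Poly k Ω) :=
  Finsupp.supported k k {t : Monomial Ω | t.vars = Multiset.range n}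

theorem single_mem_multilinearPoly {n : ℕ} {t : Monomial Ω} (ht : t.vars = Multiset.range n)
    (c : k) : Finsupp.single t c ∈ multilinearPoly k Ω n :=
  Finsupp.single_mem_supported k c ht

theorem multilinearPoly_eq_span (n : ℕ) : multilinearPoly k Ω n =
    Submodule.span k ((fun t => Finsupp.single t 1) '' {t | t.vars = Multiset.range n}) :=
  Finsupp.supported_eq_span_single _ _

theorem eqOn_multilinearPoly {X : Type w} [AddCommGroup X] [Module k X] {n : ℕ}
    {F G : Poly k Ω →ₗ[k] X} (h : ∀ t : Monomial Ω, t.vars = Multiset.range n →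
      F (Finsupp.single t 1) = G (Finsupp.single t 1)) {f : Poly k Ω}
    (hf : f ∈ multilinearPoly k Ω n) : F f = G f := by
  rw [multilinearPoly_eq_span] at hf
  refine LinearMap.eqOn_span (R := k) ?_ hf
  rintro _ ⟨t, ht, rfl⟩
  exact h t ht

/-- The linear extension of `Monomial.mark`. -/
def Poly.mark (i : ℕ) : Poly k Ω →ₗ[k] Poly k (Ω ⊕ Ω) :=
  Finsupp.lmapDomain k k (Monomial.mark i)

theorem Poly.mark_single (i : ℕ) (t : Monomial Ω) (c : k) :
    Poly.mark i (Finsupp.single t c) = Finsupp.single (t.mark i) c := by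
  simp [Poly.mark]

theorem Poly.mark_mem {n : ℕ} (i : ℕ) {f : Poly k Ω} (hf : f ∈ multilinearPoly k Ω n) :
    Poly.mark i f ∈ multilinearPoly k (Ω ⊕ Ω) n := by
  rw [multilinearPoly_eq_span] at hf
  refine (Submodule.span_le (p := (multilinearPoly k (Ω ⊕ Ω) n).comap (Poly.mark i))).2 ?_ hf
  rintro _ ⟨t, ht, rfl⟩
  change Poly.mark i (Finsupp.single t 1) ∈ multilinearPoly k (Ω ⊕ Ω) n
  rw [Poly.mark_single]
  exact single_mem_multilinearPoly (by rw [Monomial.vars_mark]; exact ht) _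

theorem Poly.eval_eq_zero_of_multilinear (A : OpAlg.{u, v, w} k Ω) {n i : ℕ} (hi : i < n)
    {f : Poly k Ω} (hf : f ∈ multilinearPoly k Ω n) {x : ℕ → A.carrier} (hx : x i = 0) :
    Poly.eval A x f = 0 := by
  refine eqOn_multilinearPoly (F := Poly.eval A x) (G := 0) (fun t ht => ?_) hf
  rw [Poly.eval_single, Monomial.eval_eq_zero A t (i := i) (by rw [ht]; simpa using hi) hx]
  simp

namespace NullEnvelope

variable {D : OpAlg.{u, v, w} k (Ω ⊕ Ω)} {E : OpAlg.{u, v, w'} k Ω} (e : NullEnvelope D E)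

theorem base_eval_mark (x : ℕ → D.carrier) (i : ℕ) (f : Poly k Ω) :
    e.base (Poly.eval D x (Poly.mark i f)) = Poly.eval E (fun j => e.base (x j)) f := by
  have : e.base ∘ₗ Poly.eval D x ∘ₗ Poly.mark i = Poly.eval E (fun j => e.base (x j)) := by
    refine Finsupp.lhom_ext fun t c => ?_
    simp [Poly.mark_single, Poly.eval_single, e.base_eval, Monomial.forget_mark]
  exact LinearMap.congr_fun this f

theorem eval_multilinear (a m : ℕ → D.carrier) {n : ℕ} {f : Poly k Ω}
    (hf : f ∈ multilinearPoly k Ω n) :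
    Poly.eval E (fun j => e.base (a j) + e.fiber (m j)) f =
      Poly.eval E (fun j => e.base (a j)) f + e.fiber
        (∑ i ∈ Finset.range n, Poly.eval D (Function.update a i (m i)) (Poly.mark i f)) := by
  have := eqOn_multilinearPoly (F := Poly.eval E (fun j => e.base (a j) + e.fiber (m j)))
    (G := Poly.eval E (fun j => e.base (a j)) + e.fiber ∘ₗ
      ∑ i ∈ Finset.range n, Poly.eval D (Function.update a i (m i)) ∘ₗ Poly.mark i)
    (fun t ht => ?_) hf
  · simpa using this
  · have hv : t.vars.toFinset = Finset.range n := by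
      rw [ht]; ext; simp
    simp [Poly.eval_single, Poly.mark_single,
      e.eval_of_nodup a m t (by rw [ht]; exact Multiset.nodup_range n), hv]

end NullEnvelope

theorem Variety.mem_identities_generatedBy {C : Set (OpAlg.{u, v, max u v} k Ω)} {f : Poly k Ω} :
    f ∈ (Variety.generatedBy C).identities ↔ ∀ A ∈ C, A.Satisfies f :=
  ⟨fun h A hA => h A fun _ hg => hg A hA, fun h _ hA => hA f h⟩

/-- The split null extensions of the dialgebras of a class. -/
def hats (C : Set (OpAlg.{u, v, max u v} k (Ω ⊕ Ω))) : Set (OpAlg.{u, v, max u v} k Ω) :=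
  {E | ∃ D ∈ C, ∃ h : D.BarInvariant, E = h.hat}

variable {C : Set (OpAlg.{u, v, max u v} k (Ω ⊕ Ω))}

/-- Both directions read off the components of the first-order expansion `eval_multilinear`. -/
theorem mem_identities_hats (hC : ∀ D ∈ C, D.BarInvariant) {n : ℕ} (hn : 1 ≤ n) {f : Poly k Ω}
    (hf : f ∈ multilinearPoly k Ω n) :
    f ∈ (Variety.generatedBy (hats C)).identities ↔
      ∀ i < n, Poly.mark i f ∈ (Variety.generatedBy C).identities := by
  simp only [Variety.mem_identities_generatedBy]
  constructor
  · intro h i hi D hD x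
    have hs := h _ ⟨D, hD, hC D hD, rfl⟩
    let e := (hC D hD).envelope
    -- Only the variable `i` receives a fiber part, so the sum over centres collapses to the marking
    -- at `i`, evaluated at `x` itself.
    have key := e.eval_multilinear x (fun j => if j = i then x i else 0) hf
    rw [hs _, hs _, zero_add, eq_comm, map_eq_zero_iff _ e.fiber_injective,
      Finset.sum_eq_single_of_mem i (Finset.mem_range.2 hi)] at key
    · simpa using key
    · intro j hj hji
      exact Poly.eval_eq_zero_of_multilinear D (Finset.mem_range.1 hj) (Poly.mark_mem j hf)
        (by simp [hji])
  · rintro h _ ⟨D, hD, hb, rfl⟩ z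
    choose a m ham using fun j => hb.exists_base_add_fiber (z j)
    obtain rfl : z = fun j => hb.envelope.base (a j) + hb.envelope.fiber (m j) := funext ham
    -- The base component is the image of any marking of `f`; marking at `0` is available because `1
    -- ≤ n`.
    rw [hb.envelope.eval_multilinear a m hf, ← hb.envelope.base_eval_mark a 0 f, h 0 hn D hD,
      Finset.sum_eq_zero fun i hi => h i (Finset.mem_range.1 hi) D hD _]
    simp

theorem rank_range_le_of_ker_le {X : Type w} {Y Z : Type w'} [AddCommGroup X] [Module k X]
    [AddCommGroup Y] [Module k Y] [AddCommGroup Z] [Module k Z] (f : X →ₗ[k] Y) (g : X →ₗ[k] Z)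
    (h : LinearMap.ker g ≤ LinearMap.ker f) :
    Module.rank k (LinearMap.range f) ≤ Module.rank k (LinearMap.range g) := by
  have h1 := f.quotKerEquivRange.lift_rank_eq
  have h2 := g.quotKerEquivRange.lift_rank_eq
  have h3 : Module.rank k (X ⧸ LinearMap.ker f) ≤ Module.rank k (X ⧸ LinearMap.ker g) :=
    LinearMap.rank_le_of_surjective (Submodule.factor h) (Submodule.factor_surjective h)
  rw [← Cardinal.lift_le.{w}, ← h1, ← h2, Cardinal.lift_le]
  exact h3

/-- The maps `g i` jointly determine `f`, so its range is a quotient of a subspace of `Sⁿ`. -/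
theorem rank_range_le_nat_mul {X : Type w} {Y Z : Type w'} [AddCommGroup X] [Module k X]
    [AddCommGroup Y] [Module k Y] [AddCommGroup Z] [Module k Z] {n : ℕ} (f : X →ₗ[k] Z)
    (g : Fin n → X →ₗ[k] Y) (S : Submodule k Y) (hS : ∀ i x, g i x ∈ S)
    (h : ∀ x, (∀ i, g i x = 0) → f x = 0) :
    Module.rank k (LinearMap.range f) ≤ n * Module.rank k S := by
  let G : X →ₗ[k] (Fin n → S) := LinearMap.pi fun i => (g i).codRestrict S (hS i)
  calc _ ≤ Module.rank k (LinearMap.range G) :=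
        rank_range_le_of_ker_le f G fun x hx =>
          h x fun i => congrArg Subtype.val (congrFun (LinearMap.mem_ker.1 hx) i)
    _ ≤ Module.rank k (Fin n → S) := Submodule.rank_le (LinearMap.range G)
    _ = _ := by rw [rank_pi]; simp

/-- The sum of the `f i` on `Xⁿ` covers `S` and depends on each coordinate only through `g`. -/
theorem rank_le_nat_mul_rank_range {X : Type w} {Y Z : Type w'} [AddCommGroup X] [Module k X]
    [AddCommGroup Y] [Module k Y] [AddCommGroup Z] [Module k Z] {n : ℕ} (f : Fin n → X →ₗ[k] Z)
    (g : X →ₗ[k] Y) (S : Submodule k Z) (hS : S ≤ ⨆ i, LinearMap.range (f i))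
    (h : ∀ i x, g x = 0 → f i x = 0) :
    Module.rank k S ≤ n * Module.rank k (LinearMap.range g) := by
  let F : (Fin n → X) →ₗ[k] Z := ∑ i, f i ∘ₗ LinearMap.proj i
  have hF : (⨆ i, LinearMap.range (f i)) ≤ LinearMap.range F := by
    refine iSup_le fun i => ?_
    rintro _ ⟨x, rfl⟩
    refine ⟨Pi.single i x, ?_⟩
    simp only [F, LinearMap.sum_apply]
    rw [Finset.sum_eq_single_of_mem i (Finset.mem_univ _)]
    · simp
    · intro j _ hj
      simp [Pi.single_eq_of_ne hj]
  calc _ ≤ Module.rank k (LinearMap.range F) := Submodule.rank_mono (hS.trans hF)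
    _ ≤ _ := by
      refine rank_range_le_nat_mul F (fun i => g ∘ₗ LinearMap.proj i) _
        (fun i x => ⟨x i, rfl⟩) fun x hx => ?_
      simp only [F, LinearMap.sum_apply]
      exact Finset.sum_eq_zero fun i _ => h i (x i) (hx i)

theorem rank_map_mkQ_le_of_mark (I : Submodule k (Poly k Ω)) (J : Submodule k (Poly k (Ω ⊕ Ω)))
    (n : ℕ) (h : ∀ f ∈ multilinearPoly k Ω n, (∀ i < n, Poly.mark i f ∈ J) → f ∈ I) :
    Module.rank k ((multilinearPoly k Ω n).map I.mkQ) ≤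
      n * Module.rank k ((multilinearPoly k (Ω ⊕ Ω) n).map J.mkQ) := by
  have := rank_range_le_nat_mul.{u, max u v, max u v} (X := multilinearPoly k Ω n)
    (Y := Poly k (Ω ⊕ Ω) ⧸ J) (Z := Poly k Ω ⧸ I) (I.mkQ ∘ₗ (multilinearPoly k Ω n).subtype)
    (fun i : Fin n => (J.mkQ ∘ₗ Poly.mark i) ∘ₗ (multilinearPoly k Ω n).subtype)
    ((multilinearPoly k (Ω ⊕ Ω) n).map J.mkQ)
    (fun i f => Submodule.mem_map_of_mem (Poly.mark_mem i f.2))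
  rw [LinearMap.range_comp, Submodule.range_subtype] at this
  exact this fun f hf => (Submodule.Quotient.mk_eq_zero _).2
    (h f f.2 fun i hi => (Submodule.Quotient.mk_eq_zero _).1 (hf ⟨i, hi⟩))

/-- By `hJ`, every multilinear dimonomial is, modulo `J`, a marking at one of `n` possible centres,
and by `h` each marking factors through the quotient by `I`. -/
theorem rank_map_mkQ_le_of_centre (I : Submodule k (Poly k Ω)) (J : Submodule k (Poly k (Ω ⊕ Ω)))
    (n : ℕ) (h : ∀ f ∈ multilinearPoly k Ω n, f ∈ I → ∀ i < n, Poly.mark i f ∈ J)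
    (hJ : ∀ t : Monomial (Ω ⊕ Ω), t.vars.Nodup →
      Finsupp.single (t.forget.mark t.centre) 1 - Finsupp.single t 1 ∈ J) :
    Module.rank k ((multilinearPoly k (Ω ⊕ Ω) n).map J.mkQ) ≤
      n * Module.rank k ((multilinearPoly k Ω n).map I.mkQ) := by
  have := rank_le_nat_mul_rank_range.{u, max u v, max u v} (X := multilinearPoly k Ω n)
    (Y := Poly k Ω ⧸ I) (Z := Poly k (Ω ⊕ Ω) ⧸ J)
    (fun i : Fin n => (J.mkQ ∘ₗ Poly.mark i) ∘ₗ (multilinearPoly k Ω n).subtype)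
    (I.mkQ ∘ₗ (multilinearPoly k Ω n).subtype) ((multilinearPoly k (Ω ⊕ Ω) n).map J.mkQ)
  rw [LinearMap.range_comp, Submodule.range_subtype] at this
  refine this ?_ fun i f hf => (Submodule.Quotient.mk_eq_zero _).2
    (h f f.2 ((Submodule.Quotient.mk_eq_zero _).1 hf) i i.2)
  rw [multilinearPoly_eq_span, Submodule.map_span_le]
  rintro _ ⟨t, ht, rfl⟩
  rw [Set.mem_ofPred_eq] at ht
  have hc : t.centre < n := by
    have := t.centre_mem
    rw [ht] at this
    simpa using this
  refine Submodule.mem_iSup_of_mem ⟨t.centre, hc⟩ ⟨⟨Finsupp.single t.forget 1,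
    single_mem_multilinearPoly (by rw [t.vars_forget]; exact ht) _⟩, ?_⟩
  simp only [LinearMap.comp_apply, Submodule.subtype_apply, Poly.mark_single]
  exact (Submodule.Quotient.eq _).2 (hJ t (by rw [ht]; exact Multiset.nodup_range n))

theorem rank_multilinear_hats_le (hC : ∀ D ∈ C, D.BarInvariant) {n : ℕ} (hn : 1 ≤ n) :
    Module.rank k ((Variety.generatedBy (hats C)).multilinear n) ≤
      n * Module.rank k ((Variety.generatedBy C).multilinear n) :=
  rank_map_mkQ_le_of_mark _ _ n fun _ hf => (mem_identities_hats hC hn hf).2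

theorem rank_multilinear_le_hats (hC : ∀ D ∈ C, D.BarInvariant) {n : ℕ} (hn : 1 ≤ n) :
    Module.rank k ((Variety.generatedBy C).multilinear n) ≤
      n * Module.rank k ((Variety.generatedBy (hats C)).multilinear n) :=
  rank_map_mkQ_le_of_centre _ _ n (fun _ hf => (mem_identities_hats hC hn hf).1) fun t ht =>
    Variety.mem_identities_generatedBy.2 fun D hD x => by
      rw [map_sub, Poly.eval_single, Poly.eval_single,
        (hC D hD).envelope.eval_mark_centre x t ht, sub_self]

theorem codim_hats_le (hC : ∀ D ∈ C, D.BarInvariant) {n : ℕ} (hn : 1 ≤ n) :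
    (Variety.generatedBy (hats C)).codim n ≤ n * (Variety.generatedBy C).codim n := by
  have := Cardinal.toENat.monotone' (rank_multilinear_hats_le hC hn)
  simpa [Variety.codim] using this

theorem codim_le_hats (hC : ∀ D ∈ C, D.BarInvariant) {n : ℕ} (hn : 1 ≤ n) :
    (Variety.generatedBy C).codim n ≤ n * (Variety.generatedBy (hats C)).codim n := by
  have := Cardinal.toENat.monotone' (rank_multilinear_le_hats hC hn)
  simpa [Variety.codim] using this

theorem PolynomiallyBounded.of_le_mul {c d : ℕ → ℕ∞} (h : ∀ n : ℕ, 1 ≤ n → c n ≤ n * d n)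
    (hd : PolynomiallyBounded d) : PolynomiallyBounded c := by
  obtain ⟨C, r, hr⟩ := hd
  refine ⟨C, r + 1, fun n hn => (h n hn).trans ?_⟩
  calc (n : ℕ∞) * d n ≤ n * (C * n ^ r) := by gcongr; exact hr n hn
    _ = C * n ^ (r + 1) := by ring

theorem Subexponential.of_le_mul {c d : ℕ → ℕ∞} (h : ∀ n : ℕ, 1 ≤ n → c n ≤ n * d n)
    (hd : Subexponential d) : Subexponential c := by
  intro a ha
  -- Split `a` as `√a * √a`: one factor bounds `d`, the other absorbs `n`.
  have hb : 1 < Real.sqrt a := by rwa [Real.lt_sqrt zero_le_one, one_pow]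
  obtain ⟨C, hC⟩ := hd _ hb
  obtain ⟨B, hB⟩ : ∃ B : ℝ, ∀ n : ℕ, (n : ℝ) ≤ B * Real.sqrt a ^ n := by
    -- The constant comes from Bernoulli's inequality `1 + n (√a - 1) ≤ √a ^ n`.
    refine ⟨1 / (Real.sqrt a - 1), fun n => ?_⟩
    have hpos : 0 < Real.sqrt a - 1 := by linarith
    rw [div_mul_eq_mul_div, one_mul, le_div_iff₀ hpos]
    have := one_add_mul_le_pow (a := Real.sqrt a - 1) (by linarith) n
    rw [add_sub_cancel] at this
    linarith
  have hs : Real.sqrt a * Real.sqrt a = a := Real.mul_self_sqrt (by linarith)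
  have hs0 : 0 ≤ Real.sqrt a := Real.sqrt_nonneg a
  refine ⟨B * C, fun n hn => ?_⟩
  calc (c n : ENNReal) ≤ ((n * d n : ℕ∞) : ENNReal) := by exact_mod_cast h n hn
    _ = ENNReal.ofReal n * (d n : ENNReal) := by
        rw [ENNReal.ofReal_natCast]; simp
    _ ≤ ENNReal.ofReal (B * Real.sqrt a ^ n) * ENNReal.ofReal (C * Real.sqrt a ^ n) := by
        gcongr
        · exact hB n
        · exact hC n hn
    -- Only the first factor has to be nonnegative, so the sign of `C` is irrelevant.
    _ = ENNReal.ofReal ((B * Real.sqrt a ^ n) * (C * Real.sqrt a ^ n)) :=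
        (ENNReal.ofReal_mul ((Nat.cast_nonneg n).trans (hB n))).symm
    _ = _ := by
        congr 1
        conv_rhs => rw [← hs, mul_pow]
        ring

/-- A class of dialgebras whose split null extensions lie in a variety without subvarieties of
intermediate growth does not generate a variety of intermediate growth. -/
theorem not_intermediateGrowth_of_hats {M : Variety k Ω} (hM : M.NoIntermediateSubvariety)
    (hC : ∀ D ∈ C, D.BarInvariant) (hCM : hats C ⊆ M.algebras) :
    ¬ IntermediateGrowth (Variety.generatedBy C).codim := by
  rintro ⟨h1, h2⟩
  -- The two codimension bounds serve opposite ends: subexponentiality passes to the hats, while a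
  -- polynomial bound would pass back from them.
  refine hM (Variety.generatedBy (hats C)) ?_
    ⟨h1.of_le_mul fun n hn => codim_hats_le hC hn,
      fun h => h2 (h.of_le_mul fun n hn => codim_le_hats hC hn)⟩
  obtain ⟨S, hS⟩ := M.exists_identities
  intro A hA
  rw [hS]
  intro f hf
  refine hA f fun E hE => ?_
  have := hCM hE
  rw [hS] at this
  exact this f hf

end CodimensionComparison

/-! ### Stability of identities under scalar extension -/

section ScalarExtension

variable {k : Type u} [Field k] {Ω : Type v}

/-- The algebra `R ⊗ A` for a commutative algebra `R`. -/
def OpAlg.scalarExt (R : Type w') [CommRing R] [Algebra k R] (A : OpAlg.{u, v, w} k Ω) :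
    OpAlg.{u, v, max w w'} k Ω where
  carrier := R ⊗[k] A.carrier
  op ω := TensorProduct.map₂ (LinearMap.mul k R) (A.op ω)

theorem tensorProduct_ext₂ {X Y Z A B : Type*} [AddCommGroup X] [Module k X] [AddCommGroup Y]
    [Module k Y] [AddCommGroup Z] [Module k Z] [AddCommGroup A] [Module k A] [AddCommGroup B]
    [Module k B] {F G : X ⊗[k] A →ₗ[k] Y ⊗[k] B →ₗ[k] Z}
    (h : ∀ x a y b, F (x ⊗ₜ a) (y ⊗ₜ b) = G (x ⊗ₜ a) (y ⊗ₜ b)) : F = G := by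
  refine TensorProduct.ext' fun x a => TensorProduct.ext' fun y b => h x a y b

theorem Poly.map_eval {A : OpAlg.{u, v, w} k Ω} {B : OpAlg.{u, v, w'} k Ω}
    (φ : A.carrier →ₗ[k] B.carrier) (hφ : ∀ ω a b, φ (A.op ω a b) = B.op ω (φ a) (φ b))
    (x : ℕ → A.carrier) (f : Poly k Ω) :
    φ (Poly.eval A x f) = Poly.eval B (fun j => φ (x j)) f := by
  have ht : ∀ t : Monomial Ω, φ (t.eval A x) = t.eval B (fun j => φ (x j)) := fun t => by
    induction t with
    | var i => rfl
    | mul ω s t hs ht => simp [Monomial.eval, hφ, hs, ht]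
  have : φ ∘ₗ Poly.eval A x = Poly.eval B (fun j => φ (x j)) :=
    Finsupp.lhom_ext fun t c => by simp [Poly.eval_single, ht]
  exact LinearMap.congr_fun this f

theorem OpAlg.scalarExt_map (A : OpAlg.{u, v, w} k Ω) {R : Type*} {S : Type*} [CommRing R]
    [Algebra k R] [CommRing S] [Algebra k S] (φ : R →ₐ[k] S) (ω : Ω)
    (a b : R ⊗[k] A.carrier) :
    φ.toLinearMap.rTensor A.carrier ((A.scalarExt R).op ω a b) =
      (A.scalarExt S).op ω (φ.toLinearMap.rTensor A.carrier a)
        (φ.toLinearMap.rTensor A.carrier b) := by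
  have : ((A.scalarExt R).op ω).compr₂ (φ.toLinearMap.rTensor A.carrier) =
      ((A.scalarExt S).op ω).compl₁₂ (φ.toLinearMap.rTensor A.carrier)
        (φ.toLinearMap.rTensor A.carrier) := by
    refine tensorProduct_ext₂ fun x a y b => ?_
    change φ (x * y) ⊗ₜ[k] A.op ω a b = (φ x * φ y) ⊗ₜ[k] A.op ω a b
    rw [map_mul]
  exact LinearMap.congr_fun₂ this a b

/-- In a basis of `A` the coordinates of `z` are polynomials, and a polynomial vanishing at all
points of an infinite field is zero. -/
theorem MvPolynomial.tensor_eq_zero [Infinite k] {σ : Type w'} {A : Type w} [AddCommGroup A]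
    [Module k A] (z : MvPolynomial σ k ⊗[k] A)
    (h : ∀ t : σ → k, (MvPolynomial.aeval t).toLinearMap.rTensor A z = (0 : k ⊗[k] A)) :
    z = 0 := by
  let b := Module.Basis.ofVectorSpace k A
  apply (Algebra.TensorProduct.basis (MvPolynomial σ k) b).repr.injective
  rw [map_zero]
  ext1 i
  refine MvPolynomial.funext fun t => ?_
  have key : ∀ z : MvPolynomial σ k ⊗[k] A, MvPolynomial.eval t
      ((Algebra.TensorProduct.basis (MvPolynomial σ k) b).repr z i) =
      b.repr (TensorProduct.lid k A ((MvPolynomial.aeval t).toLinearMap.rTensor A z)) i := by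
    intro z
    induction z with
    | zero => simp
    | add x y hx hy => simp only [map_add, Finsupp.add_apply, hx, hy]
    | tmul p a =>
      simp [Algebra.TensorProduct.basis_repr_tmul, MvPolynomial.aeval_eq_eval]
  rw [key, h]
  simp

/-- For a polynomial ring the identity is checked after specializing the indeterminates in `k`. A
general `R` is a quotient of the polynomial ring on its own elements, so points lift. No
multilinearity of `f` is required. -/
theorem OpAlg.Satisfies.scalarExt [Infinite k] {A : OpAlg.{u, v, w} k Ω} {f : Poly k Ω}
    (hf : A.Satisfies f) (R : Type w') [CommRing R] [Algebra k R] :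
    (A.scalarExt R).Satisfies f := by
  have hk : (A.scalarExt k).Satisfies f := fun x => by
    apply (TensorProduct.lid k A.carrier).injective
    have := Poly.map_eval (A := A.scalarExt k) (B := A)
      (TensorProduct.lid k A.carrier).toLinearMap (fun ω a b => ?_) x f
    · rw [hf] at this
      exact this.trans (map_zero (TensorProduct.lid k A.carrier)).symm
    · have : ((A.scalarExt k).op ω).compr₂ (TensorProduct.lid k A.carrier).toLinearMap =
          (A.op ω).compl₁₂ (TensorProduct.lid k A.carrier).toLinearMap
            (TensorProduct.lid k A.carrier).toLinearMap := by
        refine tensorProduct_ext₂ fun x a y b => ?_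
        change (x * y) • A.op ω a b = A.op ω (x • a) (y • b)
        rw [map_smul, map_smul, LinearMap.smul_apply, smul_smul, mul_comm]
      exact LinearMap.congr_fun₂ this a b
  have hp : (A.scalarExt (MvPolynomial R k)).Satisfies f := fun x => by
    refine MvPolynomial.tensor_eq_zero _ fun t => ?_
    exact (Poly.map_eval (A := A.scalarExt (MvPolynomial R k)) (B := A.scalarExt k) _
      (A.scalarExt_map (MvPolynomial.aeval t)) x f).trans (hk _)
  intro x
  let φ : MvPolynomial R k →ₐ[k] R := MvPolynomial.aeval id
  have hφ : Function.Surjective φ := fun r => ⟨MvPolynomial.X r, by simp [φ]⟩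
  choose y hy using fun j => LinearMap.rTensor_surjective A.carrier (g := φ.toLinearMap) hφ (x j)
  obtain rfl : (fun j => φ.toLinearMap.rTensor A.carrier (y j)) = x := funext hy
  have := Poly.map_eval (A := A.scalarExt (MvPolynomial R k)) (B := A.scalarExt R) _
    (A.scalarExt_map φ) y f
  rw [hp y] at this
  exact this.symm.trans (map_zero (φ.toLinearMap.rTensor A.carrier))

end ScalarExtension

/-! ### Perm-algebras inside commutative algebras -/

section PermEnvelope

variable {k : Type u} [Field k] {Ω : Type v} {P : Type w} [AddCommGroup P] [Module k P]

/-- The ring is the trivial square-zero extension `C ⊕ P`, with `α` landing in `C` and `β` the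
inclusion of `P`. -/
theorem exists_squareZero_of_action {C : Type w} [CommRing C] [Algebra k C] [Module C P]
    [IsScalarTower k C P] (mul : P →ₗ[k] P →ₗ[k] P) (α : P →ₗ[k] C)
    (hα : ∀ p q, α (mul p q) = α p * α q) (hαm : ∀ p q, mul p q = α p • q) :
    ∃ (R : Type w) (_ : CommRing R) (_ : Algebra k R) (α β : P →ₗ[k] R),
      Function.Injective β ∧ (∀ p q, α (mul p q) = α p * α q) ∧
      (∀ p q, β (mul p q) = α p * β q) ∧ ∀ p q, β p * β q = 0 := by
  let _ : Module Cᵐᵒᵖ P :=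
    Module.compHom P ((RingHom.id C).fromOpposite fun a b => mul_comm a b)
  have : IsCentralScalar C P := ⟨fun c p => rfl⟩
  refine ⟨TrivSqZeroExt C P, inferInstance, inferInstance,
    (TrivSqZeroExt.inlAlgHom k C P).toLinearMap ∘ₗ α,
    (TrivSqZeroExt.inrHom C P).restrictScalars k, TrivSqZeroExt.inr_injective, fun p q => ?_,
    fun p q => ?_, fun p q => TrivSqZeroExt.inr_mul_inr _ _ _⟩
  · simp [hα]
  · change TrivSqZeroExt.inr (mul p q) = TrivSqZeroExt.inl (α p) * TrivSqZeroExt.inr q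
    rw [TrivSqZeroExt.inl_mul_inr, hαm]

open scoped IsMulCommutative in
/-- A `Perm`-algebra maps to a commutative algebra and embeds into it as a square-zero part. -/
theorem IsPerm.exists_commRing {mul : P →ₗ[k] P →ₗ[k] P} (h : IsPerm mul) :
    ∃ (R : Type w) (_ : CommRing R) (_ : Algebra k R) (α β : P →ₗ[k] R),
      Function.Injective β ∧ (∀ p q, α (mul p q) = α p * α q) ∧
      (∀ p q, β (mul p q) = α p * β q) ∧ ∀ p q, β p * β q = 0 := by
  -- The Perm identity says precisely that left multiplications commute; they generate the
  -- commutative algebra acting on `P`.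
  have hc : ∀ f ∈ Set.range mul, ∀ g ∈ Set.range mul, f * g = g * f := by
    rintro _ ⟨p, rfl⟩ _ ⟨q, rfl⟩
    ext r
    have := h.perm p q r
    rw [map_sub, LinearMap.sub_apply, sub_eq_zero, h.assoc, h.assoc] at this
    exact this
  have : IsMulCommutative (Algebra.adjoin k (Set.range mul)) := Algebra.isMulCommutative_adjoin k hc
  let α : P →ₗ[k] Algebra.adjoin k (Set.range mul) :=
    mul.codRestrict (Subalgebra.toSubmodule (Algebra.adjoin k (Set.range mul))) fun p =>
      Algebra.subset_adjoin ⟨p, rfl⟩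
  exact exists_squareZero_of_action mul α
    (fun p q => Subtype.ext (LinearMap.ext fun r => h.assoc p q r)) fun p q => rfl

end PermEnvelope

/-! ### Null envelopes of the generators of `di-M` -/

section PermTensor

variable {k : Type u} [Field k] {Ω : Type v} {P : Type (max u v)} [AddCommGroup P] [Module k P]

/-- The maps `α ⊗ id` and `β ⊗ id` into `R ⊗ A` do the job; commutativity of `R` reconciles the
order `q p` in `⊣`, and flatness over a field keeps `β ⊗ id` injective. -/
theorem exists_envelope_permTensor [Infinite k] {mul : P →ₗ[k] P →ₗ[k] P} (h : IsPerm mul)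
    (A : OpAlg.{u, v, max u v} k Ω) : ∃ E : OpAlg.{u, v, max u v} k Ω,
      Nonempty (NullEnvelope (permTensor mul A) E) ∧ ∀ f, A.Satisfies f → E.Satisfies f := by
  obtain ⟨R, _, _, α, β, hβ, hαα, hαβ, hββ⟩ := h.exists_commRing
  let e₁ := α.rTensor A.carrier
  let e₂ := β.rTensor A.carrier
  refine ⟨A.scalarExt R, ⟨⟨e₁, e₂, Module.Flat.rTensor_preserves_injective_linearMap _ hβ,
    fun ω => ?_, fun ω => ?_, fun ω => ?_, fun ω => ?_, fun ω => ?_⟩⟩, fun f hf => hf.scalarExt R⟩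
  · refine LinearMap.congr_fun₂ (f := ((permTensor mul A).op (.inl ω)).compr₂ e₁)
      (g := ((A.scalarExt R).op ω).compl₁₂ e₁ e₁) (tensorProduct_ext₂ fun x a y b => ?_)
    change α (mul x y) ⊗ₜ[k] A.op ω a b = (α x * α y) ⊗ₜ[k] A.op ω a b
    rw [hαα]
  · refine LinearMap.congr_fun₂ (f := ((permTensor mul A).op (.inr ω)).compr₂ e₁)
      (g := ((A.scalarExt R).op ω).compl₁₂ e₁ e₁) (tensorProduct_ext₂ fun x a y b => ?_)
    change α (mul y x) ⊗ₜ[k] A.op ω a b = (α x * α y) ⊗ₜ[k] A.op ω a b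
    rw [hαα, mul_comm]
  · refine LinearMap.congr_fun₂ (f := ((permTensor mul A).op (.inl ω)).compr₂ e₂)
      (g := ((A.scalarExt R).op ω).compl₁₂ e₁ e₂) (tensorProduct_ext₂ fun x a y b => ?_)
    change β (mul x y) ⊗ₜ[k] A.op ω a b = (α x * β y) ⊗ₜ[k] A.op ω a b
    rw [hαβ]
  · refine LinearMap.congr_fun₂ (f := ((permTensor mul A).op (.inr ω)).compr₂ e₂)
      (g := ((A.scalarExt R).op ω).compl₁₂ e₂ e₁) (tensorProduct_ext₂ fun x a y b => ?_)
    change β (mul y x) ⊗ₜ[k] A.op ω a b = (β x * α y) ⊗ₜ[k] A.op ω a b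
    rw [hαβ, mul_comm]
  · refine LinearMap.congr_fun₂ (f := ((A.scalarExt R).op ω).compl₁₂ e₂ e₂)
      (g := 0) (tensorProduct_ext₂ fun x a y b => ?_)
    change (β x * β y) ⊗ₜ[k] A.op ω a b = 0
    rw [hββ, TensorProduct.zero_tmul]

end PermTensor

/-! ### Identities of an envelope as dialgebra identities; hats lie in `M` -/

section Linearization

variable {k : Type u} [Field k] {Ω : Type v}

/-- The dimonomial with operations `⊢` only, in the variables of even index. -/
def Monomial.left : Monomial Ω → Monomial (Ω ⊕ Ω)
  | .var i => .var (2 * i)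
  | .mul ω s t => .mul (.inl ω) s.left t.left

/-- The sum over all occurrences of variables in a monomial of the dimonomials with the centre at
this occurrence; the central variables have odd indices and the other variables even ones. -/
def Monomial.linearize (k : Type u) [Field k] : Monomial Ω → Poly k (Ω ⊕ Ω)
  | .var i => Poly.X k (Ω ⊕ Ω) (2 * i + 1)
  | .mul ω s t => Poly.mul (.inl ω) (Finsupp.single s.left 1) (t.linearize k) +
      Poly.mul (.inr ω) (s.linearize k) (Finsupp.single t.left 1)

/-- The linear extension of `Monomial.left`. -/
def Poly.left : Poly k Ω →ₗ[k] Poly k (Ω ⊕ Ω) := Finsupp.lmapDomain k k Monomial.left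

/-- The linear extension of `Monomial.linearize`. -/
def Poly.linearize : Poly k Ω →ₗ[k] Poly k (Ω ⊕ Ω) :=
  Finsupp.linearCombination k (Monomial.linearize k)

namespace NullEnvelope

variable {D : OpAlg.{u, v, w} k (Ω ⊕ Ω)} {E : OpAlg.{u, v, w'} k Ω} (e : NullEnvelope D E)

theorem base_eval_left (x : ℕ → D.carrier) (f : Poly k Ω) :
    e.base (Poly.eval D x (Poly.left f)) = Poly.eval E (fun j => e.base (x (2 * j))) f := by
  have ht : ∀ t : Monomial Ω,
      e.base (t.left.eval D x) = t.eval E (fun j => e.base (x (2 * j))) := fun t => by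
    induction t with
    | var i => rfl
    | mul ω s t hs ht => simp [Monomial.eval, Monomial.left, e.base_left, hs, ht]
  have : e.base ∘ₗ Poly.eval D x ∘ₗ Poly.left = Poly.eval E (fun j => e.base (x (2 * j))) :=
    Finsupp.lhom_ext fun t c => by simp [Poly.left, Poly.eval_single, ht]
  exact LinearMap.congr_fun this f

theorem eval_eq (x : ℕ → D.carrier) (f : Poly k Ω) :
    Poly.eval E (fun j => e.base (x (2 * j)) + e.fiber (x (2 * j + 1))) f =
      e.base (Poly.eval D x (Poly.left f)) + e.fiber (Poly.eval D x (Poly.linearize f)) := by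
  have ht : ∀ t : Monomial Ω,
      t.eval E (fun j => e.base (x (2 * j)) + e.fiber (x (2 * j + 1))) =
        e.base (t.left.eval D x) + e.fiber (Poly.eval D x (t.linearize k)) := fun t => by
    induction t with
    | var i => simp [Monomial.eval, Monomial.left, Monomial.linearize, Poly.eval_X]
    | mul ω s t hs ht =>
      simp only [Monomial.eval, Monomial.left, Monomial.linearize, hs, ht, map_add,
        LinearMap.add_apply, Poly.eval_mul, Poly.eval_single, one_smul, e.base_left, e.fiber_left,
        e.fiber_right, e.fiber_fiber]
      abel
  have : Poly.eval E (fun j => e.base (x (2 * j)) + e.fiber (x (2 * j + 1))) =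
      e.base ∘ₗ Poly.eval D x ∘ₗ Poly.left + e.fiber ∘ₗ Poly.eval D x ∘ₗ Poly.linearize :=
    Finsupp.lhom_ext fun t c => by
      simp [Poly.left, Poly.linearize, Poly.eval_single, ht, smul_add]
  exact LinearMap.congr_fun this f

theorem base_eval_left_eq_zero {f : Poly k Ω} (hf : E.Satisfies f) (x : ℕ → D.carrier) :
    e.base (Poly.eval D x (Poly.left f)) = 0 := by
  rw [e.base_eval_left, hf]

/-- The images of `base` and `fiber` need not be independent in `E`; the base term is removed
because `f` already vanishes at points of the form `base`. -/
theorem satisfies_linearize (e : NullEnvelope D E) {f : Poly k Ω} (hf : E.Satisfies f) :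
    D.Satisfies (Poly.linearize f) := fun x => by
  apply e.fiber_injective
  have := e.eval_eq x f
  rwa [hf, e.base_eval_left_eq_zero hf, zero_add, ← map_zero e.fiber, eq_comm] at this

theorem satisfies_left_mul (e : NullEnvelope D E) {f : Poly k Ω} (hf : E.Satisfies f) (ω : Ω) (i : ℕ) :
    D.Satisfies (Poly.mul (.inl ω) (Poly.left f) (Poly.X k _ i)) := fun x => by
  apply e.fiber_injective
  rw [Poly.eval_mul, e.fiber_left, e.base_eval_left_eq_zero hf]
  simp

theorem satisfies_mul_left (e : NullEnvelope D E) {f : Poly k Ω} (hf : E.Satisfies f) (ω : Ω) (i : ℕ) :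
    D.Satisfies (Poly.mul (.inr ω) (Poly.X k _ i) (Poly.left f)) := fun x => by
  apply e.fiber_injective
  rw [Poly.eval_mul, e.fiber_right, e.base_eval_left_eq_zero hf]
  simp

end NullEnvelope

/-- The fiber component of a value of `f` is killed by `h₁`. The base component is the class of a
value of `Poly.left f`, which acts trivially by `h₂` and `h₃`. -/
theorem OpAlg.BarInvariant.hat_satisfies {D : OpAlg.{u, v, w} k (Ω ⊕ Ω)} (h : D.BarInvariant)
    {f : Poly k Ω} (h₁ : D.Satisfies (Poly.linearize f))
    (h₂ : ∀ ω, D.Satisfies (Poly.mul (.inl ω) (Poly.left f) (Poly.X k _ 1)))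
    (h₃ : ∀ ω, D.Satisfies (Poly.mul (.inr ω) (Poly.X k _ 1) (Poly.left f))) :
    h.hat.Satisfies f := by
  intro z
  choose a m ham using fun j => h.exists_base_add_fiber (z j)
  -- `Poly.left f` involves only even indices, so the variable `1` is free to be an arbitrary test
  -- element `d`.
  let x : D.carrier → ℕ → D.carrier := fun d j => if j % 2 = 0 then a (j / 2) else d
  let y : ℕ → D.carrier := fun j => if j % 2 = 0 then a (j / 2) else m (j / 2)
  have hy₀ : ∀ j, y (2 * j) = a j := fun j => by simp [y]
  have hy₁ : ∀ j, y (2 * j + 1) = m j := fun j => by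
    have : (2 * j + 1) / 2 = j := by omega
    simp [y, this]
  have hx₀ : ∀ d j, x d (2 * j) = a j := fun d j => by simp [x]
  have hx : ∀ d, h.envelope.base (Poly.eval D y (Poly.left f)) =
      h.envelope.base (Poly.eval D (x d) (Poly.left f)) := fun d => by
    simp only [h.envelope.base_eval_left, hy₀, hx₀]
  have key := h.envelope.eval_eq y f
  simp only [hy₀, hy₁, ← ham] at key
  rw [h₁ y, map_zero, add_zero] at key
  rw [key, h.base_eq_zero_iff]
  intro ω d
  constructor
  · apply h.envelope.fiber_injective
    rw [h.envelope.fiber_left, hx d, ← h.envelope.fiber_left]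
    have := h₂ ω (x d)
    rw [Poly.eval_mul, Poly.eval_X] at this
    exact congrArg _ this |>.trans rfl
  · apply h.envelope.fiber_injective
    rw [h.envelope.fiber_right, hx d, ← h.envelope.fiber_right]
    have := h₃ ω (x d)
    rw [Poly.eval_mul, Poly.eval_X] at this
    exact congrArg _ this |>.trans rfl

theorem barInvariant_of_mem_di [Infinite k] {M : Variety k Ω} {D : OpAlg.{u, v, max u v} k (Ω ⊕ Ω)}
    (hD : D ∈ M.di.algebras) : D.BarInvariant := by
  let X := Poly.X k (Ω ⊕ Ω)
  constructor
  · intro ω ω' a b c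
    have := hD (Poly.mul (.inl ω') (Poly.mul (.inl ω) (X 0) (X 1)) (X 2) -
      Poly.mul (.inl ω') (Poly.mul (.inr ω) (X 0) (X 1)) (X 2)) (by
        rintro _ ⟨P, _, _, mul, A, hP, hA, rfl⟩ x
        obtain ⟨E, ⟨e⟩, -⟩ := exists_envelope_permTensor hP A
        simp [Poly.eval_mul, e.barInvariant.left])
      (fun j => if j = 0 then a else if j = 1 then b else c)
    simpa [X, Poly.eval_mul, Poly.eval_X, sub_eq_zero] using this
  · intro ω ω' a b c
    have := hD (Poly.mul (.inr ω') (X 2) (Poly.mul (.inl ω) (X 0) (X 1)) -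
      Poly.mul (.inr ω') (X 2) (Poly.mul (.inr ω) (X 0) (X 1))) (by
        rintro _ ⟨P, _, _, mul, A, hP, hA, rfl⟩ x
        obtain ⟨E, ⟨e⟩, -⟩ := exists_envelope_permTensor hP A
        simp [Poly.eval_mul, e.barInvariant.right])
      (fun j => if j = 0 then a else if j = 1 then b else c)
    simpa [X, Poly.eval_mul, Poly.eval_X, sub_eq_zero] using this

/-- A dialgebra identity forced by `f` on an envelope holds on every generator `P ⊗ A`, hence on
`D`, even though `D` need not be of that form. -/
theorem hat_mem_of_mem_di [Infinite k] {M : Variety k Ω} {D : OpAlg.{u, v, max u v} k (Ω ⊕ Ω)}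
    (hD : D ∈ M.di.algebras) (h : D.BarInvariant) : h.hat ∈ M.algebras := by
  obtain ⟨S, hS⟩ := M.exists_identities
  rw [hS]
  intro f hf
  have key : ∀ g : Poly k (Ω ⊕ Ω), (∀ (D : OpAlg.{u, v, max u v} k (Ω ⊕ Ω))
      (E : OpAlg.{u, v, max u v} k Ω), NullEnvelope D E → E.Satisfies f → D.Satisfies g) →
      D.Satisfies g := fun g hg => hD g (by
    rintro _ ⟨P, _, _, mul, A, hP, hA, rfl⟩
    obtain ⟨E, ⟨e⟩, hE⟩ := exists_envelope_permTensor hP A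
    rw [hS] at hA
    exact hg _ E e (hE f (hA f hf)))
  exact h.hat_satisfies (key _ fun _ _ e he => e.satisfies_linearize he)
    (fun ω => key _ fun _ _ e he => e.satisfies_left_mul he ω 1)
    (fun ω => key _ fun _ _ e he => e.satisfies_mul_left he ω 1)

theorem Variety.eq_of_algebras_eq {V W : Variety k Ω} (h : V.algebras = W.algebras) : V = W := by
  cases V
  cases W
  cases h
  rfl

theorem Variety.generatedBy_algebras (V : Variety k Ω) : Variety.generatedBy V.algebras = V := by
  refine Variety.eq_of_algebras_eq (Set.Subset.antisymm (fun A hA => ?_) fun A hA f hf => hf A hA)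
  obtain ⟨S, hS⟩ := V.exists_identities
  rw [hS]
  intro f hf
  refine hA f fun B hB => ?_
  rw [hS] at hB
  exact hB f hf

theorem Variety.NoIntermediateSubvariety.di [Infinite k] {M : Variety k Ω}
    (hM : M.NoIntermediateSubvariety) : M.di.NoIntermediateSubvariety := by
  intro V hV
  rw [← V.generatedBy_algebras]
  refine not_intermediateGrowth_of_hats hM (fun D hD => barInvariant_of_mem_di (hV hD)) ?_
  rintro _ ⟨D, hD, h, rfl⟩
  exact hat_mem_of_mem_di (hV hD) h

end Linearization

/-! ### Codimensions under a change of operations -/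

section Translation

variable {k : Type u} [Field k] {Ω₁ Ω₂ : Type v}

theorem rank_range_eq_of_ker_eq {X : Type w} {Y Z : Type w'} [AddCommGroup X] [Module k X]
    [AddCommGroup Y] [Module k Y] [AddCommGroup Z] [Module k Z] (f : X →ₗ[k] Y) (g : X →ₗ[k] Z)
    (h : LinearMap.ker f = LinearMap.ker g) :
    Module.rank k (LinearMap.range f) = Module.rank k (LinearMap.range g) :=
  le_antisymm (rank_range_le_of_ker_le f g h.ge) (rank_range_le_of_ker_le g f h.le)

/-- The translation need not be injective: it suffices that `I` is the preimage of `J` and that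
multilinear polynomials are hit. -/
theorem rank_map_mkQ_eq_of_translation (φ : Poly k Ω₁ →ₗ[k] Poly k Ω₂) (n : ℕ)
    (hφ : (multilinearPoly k Ω₁ n).map φ = multilinearPoly k Ω₂ n) (I : Submodule k (Poly k Ω₁))
    (J : Submodule k (Poly k Ω₂)) (h : ∀ f, f ∈ I ↔ φ f ∈ J) :
    Module.rank k ((multilinearPoly k Ω₁ n).map I.mkQ) =
      Module.rank k ((multilinearPoly k Ω₂ n).map J.mkQ) := by
  let F : multilinearPoly k Ω₁ n →ₗ[k] Poly k Ω₁ ⧸ I := I.mkQ ∘ₗ (multilinearPoly k Ω₁ n).subtype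
  let G : multilinearPoly k Ω₁ n →ₗ[k] Poly k Ω₂ ⧸ J :=
    (J.mkQ ∘ₗ φ) ∘ₗ (multilinearPoly k Ω₁ n).subtype
  have hF : (multilinearPoly k Ω₁ n).map I.mkQ = LinearMap.range F := by
    rw [LinearMap.range_comp, Submodule.range_subtype]
  have hG : (multilinearPoly k Ω₂ n).map J.mkQ = LinearMap.range G := by
    rw [LinearMap.range_comp, Submodule.range_subtype, ← hφ, Submodule.map_comp]
  have hFG : LinearMap.ker F = LinearMap.ker G := by
    ext f
    rw [LinearMap.mem_ker, LinearMap.mem_ker]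
    exact (Submodule.Quotient.mk_eq_zero _).trans
      ((h f).trans (Submodule.Quotient.mk_eq_zero _).symm)
  rw [hF, hG]
  exact rank_range_eq_of_ker_eq.{u, max u v, max u v} (X := multilinearPoly k Ω₁ n)
    (Y := Poly k Ω₁ ⧸ I) (Z := Poly k Ω₂ ⧸ J) F G hFG

end Translation

/-! ### Leibniz algebras as dialgebras over Lie algebras -/

section Leibniz

variable {k : Type u} [Field k]

/-- The dialgebra with `x ⊢ y = [x, y]` and `x ⊣ y = -[y, x]`. -/
def OpAlg.opposed (D : OpAlg.{u, 0, w} k Unit) : OpAlg.{u, 0, w} k (Unit ⊕ Unit) where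
  carrier := D.carrier
  op
    | .inl ω => D.op ω
    | .inr ω => -(D.op ω).flip

/-- The translation of a dimonomial along `x ⊢ y = [x, y]` and `x ⊣ y = -[y, x]`. -/
def Monomial.unoppose (k : Type u) [Field k] : Monomial (Unit ⊕ Unit) → Poly k Unit
  | .var i => Poly.X k Unit i
  | .mul (.inl ω) s t => Poly.mul ω (s.unoppose k) (t.unoppose k)
  | .mul (.inr ω) s t => -Poly.mul ω (t.unoppose k) (s.unoppose k)

/-- The linear extension of `Monomial.unoppose`. -/
def Poly.unoppose : Poly k (Unit ⊕ Unit) →ₗ[k] Poly k Unit :=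
  Finsupp.linearCombination k (Monomial.unoppose k)

theorem Poly.eval_unoppose (D : OpAlg.{u, 0, w} k Unit) (x : ℕ → D.carrier)
    (f : Poly k (Unit ⊕ Unit)) :
    Poly.eval D x (Poly.unoppose f) = Poly.eval D.opposed x f := by
  have ht : ∀ t : Monomial (Unit ⊕ Unit),
      Poly.eval D x (t.unoppose k) = t.eval D.opposed x := fun t => by
    induction t with
    | var i => exact Poly.eval_X _ _ _
    | mul ω s t hs ht =>
      cases ω with
      | inl ω =>
        rw [Monomial.unoppose, Poly.eval_mul, hs, ht]
        rfl
      | inr ω =>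
        rw [Monomial.unoppose, map_neg, Poly.eval_mul, hs, ht]
        rfl
  have : Poly.eval D x ∘ₗ Poly.unoppose = Poly.eval D.opposed x :=
    Finsupp.lhom_ext fun t c => by
      rw [LinearMap.comp_apply, Poly.unoppose, Finsupp.linearCombination_single, map_smul, ht]
      exact (Poly.eval_single D.opposed x t c).symm
  exact LinearMap.congr_fun this f

theorem Poly.mul_single {Ω : Type v} (ω : Ω) (s t : Monomial Ω) (a b : k) :
    Poly.mul ω (Finsupp.single s a) (Finsupp.single t b) =
      Finsupp.single (.mul ω s t) (a * b) := by
  simp [Poly.mul]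

theorem Monomial.exists_unoppose_eq_single (t : Monomial (Unit ⊕ Unit)) :
    ∃ (s : Monomial Unit) (c : k), s.vars = t.vars ∧ t.unoppose k = Finsupp.single s c := by
  induction t with
  | var i => exact ⟨.var i, 1, rfl, rfl⟩
  | mul ω s t hs ht =>
    obtain ⟨s', a, hs, hs'⟩ := hs
    obtain ⟨t', b, ht, ht'⟩ := ht
    cases ω with
    | inl ω =>
      refine ⟨.mul ω s' t', a * b, by simp [Monomial.vars, hs, ht], ?_⟩
      rw [Monomial.unoppose, hs', ht', Poly.mul_single]
    | inr ω =>
      refine ⟨.mul ω t' s', -(b * a), by simp [Monomial.vars, hs, ht, add_comm], ?_⟩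
      rw [Monomial.unoppose, hs', ht', Poly.mul_single, Finsupp.single_neg]

theorem Monomial.exists_single_eq_unoppose (t : Monomial Unit) :
    ∃ s : Monomial (Unit ⊕ Unit), s.vars = t.vars ∧ s.unoppose k = Finsupp.single t 1 := by
  induction t with
  | var i => exact ⟨.var i, rfl, rfl⟩
  | mul ω s t hs ht =>
    obtain ⟨s', hs, hs'⟩ := hs
    obtain ⟨t', ht, ht'⟩ := ht
    refine ⟨.mul (.inl ω) s' t', by simp [Monomial.vars, hs, ht], ?_⟩
    rw [Monomial.unoppose, hs', ht', Poly.mul_single, one_mul]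

theorem map_unoppose_multilinearPoly (n : ℕ) :
    (multilinearPoly k (Unit ⊕ Unit) n).map Poly.unoppose = multilinearPoly k Unit n := by
  apply le_antisymm
  · rw [multilinearPoly_eq_span, Submodule.map_span_le]
    rintro _ ⟨t, ht, rfl⟩
    obtain ⟨s, c, hs, hs'⟩ := t.exists_unoppose_eq_single (k := k)
    rw [Poly.unoppose, Finsupp.linearCombination_single, one_smul, hs']
    exact single_mem_multilinearPoly (hs.trans ht) c
  · conv_lhs => rw [multilinearPoly_eq_span]
    rw [Submodule.span_le]
    rintro _ ⟨t, ht, rfl⟩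
    obtain ⟨s, hs, hs'⟩ := t.exists_single_eq_unoppose (k := k)
    refine ⟨Finsupp.single s 1, single_mem_multilinearPoly (hs.trans ht) 1, ?_⟩
    rw [Poly.unoppose, Finsupp.linearCombination_single, one_smul, hs']

/-- The second operation is expressible through the first, so doubling the signature creates no new
multilinear elements. -/
theorem codim_opposed (V : Variety k Unit) :
    (Variety.generatedBy (OpAlg.opposed '' V.algebras)).codim = V.codim := by
  funext n
  refine congrArg Cardinal.toENat (rank_map_mkQ_eq_of_translation Poly.unoppose n
    (map_unoppose_multilinearPoly n) _ _ fun f => ?_)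
  rw [Variety.mem_identities_generatedBy, Set.forall_mem_image]
  exact forall₂_congr fun D _ => forall_congr' fun x =>
    (iff_of_eq (congrArg (· = 0) (Poly.eval_unoppose D x f))).symm

theorem leibniz_of_mem_leib {D : OpAlg.{u, 0, u} k Unit} (hD : D ∈ (leib k).algebras)
    (x y z : D.carrier) : D.op () (D.op () x y) z =
      D.op () x (D.op () y z) - D.op () y (D.op () x z) := by
  have := hD (leibnizPoly k) rfl (fun j => if j = 0 then x else if j = 1 then y else z)
  simp only [leibnizPoly, map_sub, Poly.eval_mul, Poly.eval_X] at this
  simp only [if_true, one_ne_zero, if_false, OfNat.ofNat_ne_zero, OfNat.ofNat_ne_one] at this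
  rw [sub_sub, sub_eq_zero] at this
  rw [this]
  abel

theorem barInvariant_opposed {D : OpAlg.{u, 0, u} k Unit} (hD : D ∈ (leib k).algebras) :
    D.opposed.BarInvariant := by
  -- Left multiplication by `[a, b]` is the commutator of left multiplications, hence skew-symmetric
  -- in `a`, `b`.
  have key : ∀ a b c, D.op () (D.op () a b) c = D.op () (-(D.op () b a)) c := fun a b c => by
    rw [map_neg, LinearMap.neg_apply, leibniz_of_mem_leib hD, leibniz_of_mem_leib hD]
    abel
  exact ⟨fun _ _ a b c => key a b c, fun _ _ a b c => congrArg Neg.neg (key a b c)⟩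

/-- Squares `[a, a]` act trivially, so they die in the quotient, and the sign in `⊣` cancels the
mixed terms of a square. The Leibniz identity on the hat reduces to that of `D`. -/
theorem hat_opposed_mem_lie {D : OpAlg.{u, 0, u} k Unit} (hD : D ∈ (leib k).algebras)
    (h : D.opposed.BarInvariant) : h.hat ∈ (lie k).algebras := by
  let e := h.envelope
  let β : D.carrier →ₗ[k] h.hat.carrier := e.base
  let φ : D.carrier →ₗ[k] h.hat.carrier := e.fiber
  have hbb : ∀ a b, h.hat.op () (β a) (β b) = β (D.op () a b) := fun a b =>
    (e.base_left () a b).symm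
  have hbf : ∀ a b, h.hat.op () (β a) (φ b) = φ (D.op () a b) := fun a b =>
    (e.fiber_left () a b).symm
  have hfb : ∀ a b, h.hat.op () (φ a) (β b) = -φ (D.op () b a) := fun a b =>
    (e.fiber_right () a b).symm.trans (map_neg φ _)
  have hff : ∀ a b, h.hat.op () (φ a) (φ b) = 0 := e.fiber_fiber ()
  have hz : ∀ z, ∃ a m, z = β a + φ m := h.exists_base_add_fiber
  have hs : ∀ a, β (D.op () a a) = 0 := fun a => by
    refine (h.base_eq_zero_iff _).2 fun _ d => ?_
    have : D.op () (D.op () a a) d = 0 :=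
      (leibniz_of_mem_leib hD a a d).trans (sub_self _)
    exact ⟨this, (congrArg Neg.neg this).trans neg_zero⟩
  rintro f (rfl | rfl) x
  · obtain ⟨a, m, h0⟩ := hz (x 0)
    rw [Poly.eval_mul, Poly.eval_X, h0]
    simp only [map_add, LinearMap.add_apply, hbb, hbf, hfb, hff, hs]
    abel
  · obtain ⟨a, m, h0⟩ := hz (x 0)
    obtain ⟨b, n, h1⟩ := hz (x 1)
    obtain ⟨c, p, h2⟩ := hz (x 2)
    simp only [leibnizPoly, map_sub, Poly.eval_mul, Poly.eval_X, h0, h1, h2, map_add,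
      LinearMap.add_apply, map_neg, LinearMap.neg_apply, hbb, hbf, hfb, hff,
      map_zero, LinearMap.zero_apply, leibniz_of_mem_leib hD]
    abel

theorem noIntermediateSubvariety_leib (hL : (lie k).NoIntermediateSubvariety) :
    (leib k).NoIntermediateSubvariety := by
  intro V hV
  rw [← codim_opposed]
  refine not_intermediateGrowth_of_hats hL ?_ ?_
  · rintro _ ⟨D, hD, rfl⟩
    exact barInvariant_opposed (hV hD)
  · rintro _ ⟨_, ⟨D, hD, rfl⟩, h, rfl⟩
    exact hat_opposed_mem_lie (hV hD) h

end Leibniz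

end DiVar

end

theorem corollary3 (k : Type u) [Field k] [CharZero k] :
    (∀ (Ω : Type v) (M : DiVar.Variety k Ω),
      M.NoIntermediateSubvariety → M.di.NoIntermediateSubvariety) ∧
    ((DiVar.lie k).NoIntermediateSubvariety → (DiVar.leib k).NoIntermediateSubvariety) :=
  ⟨fun _ _ hM => hM.di, DiVar.noIntermediateSubvariety_leib⟩
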